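/- Let $d\ge 0$ and let $G=(V,E)$ be a simple undirected graph that is periodic: the group $\mathbb{Z}^d$ acts freely on $V$, the set of orbits $V/\mathbb{Z}^d$ is finite, and $\{gu,gw\}\in E$ for all $\{u,w\}\in E$ and $g\in\mathbb{Z}^d$. Let $v_0\in V$, and assume that every vertex in the connected component of $v_0$ has finite degree (for example, that $G$ is locally finite, or equivalently that $E/\mathbb{Z}^d$ is finite). For $k\ge 0$ let $c_k$ be the number of vertices $v\in V$ such that the length of a shortest path from $v_0$ to $v$ equals $k$. Then every $c_k$ is finite, and the generating function $\sum_{k\ge 0} c_k z^k$ is rational: there are polynomials $p_1,p_2\in\mathbb{Q}[z]$ with $p_2\neq 0$ such that $p_2(z)\sum_{k\ge 0} c_k z^k=p_1(z)$ as formal power series. -/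

import Mathlib

/-- A graph `G` on a vertex set `V` carrying an action of `ℤ^d` is periodic if the action is free,
has finitely many orbits on the vertices, and maps edges to edges. -/
structure IsPeriodicGraph (d : ℕ) {V : Type*} [AddAction (Fin d → ℤ) V] (G : SimpleGraph V) :
    Prop where
  free : ∀ (g : Fin d → ℤ) (v : V), g +ᵥ v = v → g = 0
  finite_orbits : Finite (AddAction.orbitRel.Quotient (Fin d → ℤ) V)
  adj_vadd : ∀ (g : Fin d → ℤ) (u w : V), G.Adj u w → G.Adj (g +ᵥ u) (g +ᵥ w)

/-- The set of vertices whose shortest path from `v₀` has length exactly `k`. The extended distance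
is `⊤` for vertices that cannot be reached from `v₀`, so these are in no sphere. -/
def SimpleGraph.sphereAt {V : Type*} (G : SimpleGraph V) (v₀ : V) (k : ℕ) : Set V :=
  {v | G.edist v₀ v = (k : ℕ∞)}

/-- The coordination sequence of `G` from `v₀`. -/
noncomputable def SimpleGraph.coordinationSequence {V : Type*} (G : SimpleGraph V) (v₀ : V)
    (k : ℕ) : ℕ :=
  (G.sphereAt v₀ k).ncard

/-- The generating function `∑ c_k z^k` of a sequence of natural numbers, as a formal power
series. -/
noncomputable def generatingFunction (c : ℕ → ℕ) : PowerSeries ℚ :=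
  PowerSeries.mk fun k => (c k : ℚ)

/-- A formal power series `f` is rational if `f = p₁ / p₂` for polynomials `p₁` and `p₂ ≠ 0`. -/
def PowerSeries.IsRational {K : Type*} [Field K] (f : PowerSeries K) : Prop :=
  ∃ p₁ p₂ : Polynomial K, p₂ ≠ 0 ∧ (p₂ : PowerSeries K) * f = (p₁ : PowerSeries K)

/-! Grade the pairs `(v, k)` with `G.edist v₀ v ≤ k` by `k`. The pairs with equality are what
remains after removing the image under `(v, k) ↦ (v, k + 1)`, so it suffices to treat the larger
set. Within one orbit, `v` is given by a displacement in `ℤ^d`. Classify walks by the set `S` of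
orbits they visit: a long walk contains a short segment, closed in the quotient, whose removal keeps
`S` (`exists_shorter_walk`); conversely, a closed segment based in `S` can be inserted into any walk
visiting `S`. So the pairs form a finite union, over `S`, of sets `F + M` with `F` finite and `M` a
finitely generated submonoid of `ℤ^d × ℕ`.

This union need not be disjoint, but such sets are closed under intersection
(`IsFGTranslateSet.inter`), and inclusion-exclusion reduces to a single `F + M`. There,
lexicographically least coordinate vectors reduce the count to lower sets of `ℕ^n` with positive
weights, whose complements are finite unions of orthants by Dickson's lemma. -/

namespace PowerSeries.IsRational

variable {K : Type*} [Field K] {f g : PowerSeries K}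

theorem add (hf : f.IsRational) (hg : g.IsRational) : (f + g).IsRational := by
  obtain ⟨p₁, p₂, hp, hpf⟩ := hf
  obtain ⟨q₁, q₂, hq, hqg⟩ := hg
  refine ⟨q₂ * p₁ + p₂ * q₁, p₂ * q₂, mul_ne_zero hp hq, ?_⟩
  push_cast
  rw [← hpf, ← hqg]
  ring

theorem polynomial_mul (p : Polynomial K) (hf : f.IsRational) :
    ((p : PowerSeries K) * f).IsRational := by
  obtain ⟨p₁, p₂, hp, hpf⟩ := hf
  refine ⟨p * p₁, p₂, hp, ?_⟩
  push_cast
  rw [← hpf]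
  ring

theorem of_polynomial_mul {p : Polynomial K} (hp : p ≠ 0)
    (hf : ((p : PowerSeries K) * f).IsRational) : f.IsRational := by
  obtain ⟨p₁, p₂, hp₂, hpf⟩ := hf
  refine ⟨p₁, p₂ * p, mul_ne_zero hp₂ hp, ?_⟩
  push_cast
  rw [mul_assoc, hpf]

theorem sub (hf : f.IsRational) (hg : g.IsRational) : (f - g).IsRational := by
  have h := hf.add (hg.polynomial_mul (-1))
  push_cast at h
  rwa [neg_one_mul, ← sub_eq_add_neg] at h

theorem X_pow_mul (n : ℕ) (hf : f.IsRational) : (PowerSeries.X ^ n * f).IsRational := by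
  simpa using hf.polynomial_mul (Polynomial.X ^ n)

theorem of_polynomial (p : Polynomial K) : (p : PowerSeries K).IsRational :=
  ⟨p, 1, one_ne_zero, by simp⟩

end PowerSeries.IsRational

/-! ### Sets with rational growth -/

/-- The generating function counting the elements of `s` by their degree. -/
noncomputable def Set.degreeSeries {α : Type*} (deg : α → ℕ) (s : Set α) : PowerSeries ℚ :=
  generatingFunction fun k => {x ∈ s | deg x = k}.ncard

/-- A set has rational growth if it has finitely many elements of each degree and the generating
function of their numbers is rational. -/
structure Set.HasRationalGrowth {α : Type*} (deg : α → ℕ) (s : Set α) : Prop where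
  finite : ∀ k, {x ∈ s | deg x = k}.Finite
  isRational : (s.degreeSeries deg).IsRational

namespace Set

variable {α β : Type*} {deg : α → ℕ} {s t : Set α}

theorem coeff_degreeSeries (deg : α → ℕ) (s : Set α) (k : ℕ) :
    PowerSeries.coeff k (s.degreeSeries deg) = ({x ∈ s | deg x = k}.ncard : ℚ) := by
  simp [degreeSeries, generatingFunction]

theorem degreeSeries_union (hs : ∀ k, {x ∈ s | deg x = k}.Finite)
    (ht : ∀ k, {x ∈ t | deg x = k}.Finite) (hst : Disjoint s t) :
    (s ∪ t).degreeSeries deg = s.degreeSeries deg + t.degreeSeries deg := by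
  ext k
  rw [map_add, coeff_degreeSeries, coeff_degreeSeries, coeff_degreeSeries, ← Nat.cast_add,
    ← ncard_union_eq (hst.mono (sep_subset _ _) (sep_subset _ _)) (hs k) (ht k)]
  congr 2
  ext x
  exact or_and_right

theorem degreeSeries_image {deg' : β → ℕ} {f : α → β} {c : ℕ} (hf : s.InjOn f)
    (hc : ∀ x ∈ s, deg' (f x) = deg x + c) :
    (f '' s).degreeSeries deg' = PowerSeries.X ^ c * s.degreeSeries deg := by
  ext k
  rw [PowerSeries.coeff_X_pow_mul', coeff_degreeSeries]
  split_ifs with hk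
  · rw [coeff_degreeSeries, ← (hf.mono (sep_subset _ _)).ncard_image]
    congr 2
    ext y
    constructor
    · rintro ⟨⟨x, hx, rfl⟩, hy⟩
      exact ⟨x, ⟨hx, by have := hc x hx; omega⟩, rfl⟩
    · rintro ⟨x, ⟨hx, hxk⟩, rfl⟩
      exact ⟨⟨x, hx, rfl⟩, by have := hc x hx; omega⟩
  · rw [Nat.cast_eq_zero]
    convert ncard_empty β
    rw [eq_empty_iff_forall_notMem]
    rintro y ⟨⟨x, hx, rfl⟩, hy⟩
    have := hc x hx
    omega

theorem degreeSeries_singleton (deg : α → ℕ) (a : α) :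
    ({a} : Set α).degreeSeries deg = PowerSeries.X ^ deg a := by
  ext k
  rw [coeff_degreeSeries, PowerSeries.coeff_X_pow]
  split_ifs with h
  · rw [show {x ∈ ({a} : Set α) | deg x = k} = {a} by ext x; simp; rintro rfl; exact h.symm]
    simp
  · rw [show {x ∈ ({a} : Set α) | deg x = k} = ∅ by ext x; simp; rintro rfl; exact Ne.symm h]
    simp

namespace HasRationalGrowth

theorem empty (deg : α → ℕ) : (∅ : Set α).HasRationalGrowth deg where
  finite k := by simp
  isRational := by
    convert PowerSeries.IsRational.of_polynomial (0 : Polynomial ℚ)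
    ext k
    simp [coeff_degreeSeries]

theorem union_of_disjoint (hs : s.HasRationalGrowth deg) (ht : t.HasRationalGrowth deg)
    (hst : Disjoint s t) : (s ∪ t).HasRationalGrowth deg where
  finite k := by
    refine ((hs.finite k).union (ht.finite k)).subset fun x hx => ?_
    exact hx.1.imp (fun h => ⟨h, hx.2⟩) fun h => ⟨h, hx.2⟩
  isRational := by
    rw [degreeSeries_union hs.finite ht.finite hst]
    exact hs.isRational.add ht.isRational

theorem sdiff_of_subset (hs : s.HasRationalGrowth deg) (ht : t.HasRationalGrowth deg)
    (hts : t ⊆ s) : (s \ t).HasRationalGrowth deg := by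
  have hfin : ∀ k, {x ∈ s \ t | deg x = k}.Finite := fun k =>
    (hs.finite k).subset fun x hx => ⟨hx.1.1, hx.2⟩
  refine ⟨hfin, ?_⟩
  have h := degreeSeries_union ht.finite hfin disjoint_sdiff_right
  rw [union_sdiff_cancel hts] at h
  rw [eq_sub_of_add_eq' h.symm]
  exact hs.isRational.sub ht.isRational

theorem union (hs : s.HasRationalGrowth deg) (ht : t.HasRationalGrowth deg)
    (hst : (s ∩ t).HasRationalGrowth deg) : (s ∪ t).HasRationalGrowth deg := by
  have h : s ∪ t = s ∪ t \ (s ∩ t) := by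
    ext x
    simp only [mem_union, mem_sdiff, mem_inter_iff]
    tauto
  rw [h]
  refine hs.union_of_disjoint (ht.sdiff_of_subset hst inter_subset_right) ?_
  exact disjoint_left.2 fun x hxs hx => hx.2 ⟨hxs, hx.1⟩

theorem image {deg' : β → ℕ} {f : α → β} {c : ℕ} (hs : s.HasRationalGrowth deg)
    (hf : s.InjOn f) (hc : ∀ x ∈ s, deg' (f x) = deg x + c) :
    (f '' s).HasRationalGrowth deg' where
  finite k := by
    refine ((hs.finite (k - c)).image f).subset ?_
    rintro y ⟨⟨x, hx, rfl⟩, hy⟩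
    exact ⟨x, ⟨hx, by have := hc x hx; omega⟩, rfl⟩
  isRational := by
    rw [degreeSeries_image hf hc]
    exact hs.isRational.X_pow_mul c

/-- Inclusion-exclusion: rational growth passes from a class of sets closed under intersections to
finite unions of its members. -/
theorem biUnion_of_inter {ι : Type*} {C : Set α → Prop} (hC : ∀ s, C s → s.HasRationalGrowth deg)
    (hinter : ∀ s t, C s → C t → C (s ∩ t)) (I : Finset ι) (A : ι → Set α) (hA : ∀ i ∈ I, C (A i)) :
    (⋃ i ∈ I, A i).HasRationalGrowth deg := by
  classical
  induction I using Finset.induction_on generalizing A with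
  | empty => simpa using HasRationalGrowth.empty deg
  | insert i I hi ih =>
    rw [Finset.set_biUnion_insert]
    have hI : ∀ j ∈ I, C (A j) := fun j hj => hA j (Finset.mem_insert_of_mem hj)
    have hAi := hA i (Finset.mem_insert_self i I)
    refine (hC _ hAi).union (ih A hI) ?_
    -- The intersection is a union of members of `C` over the smaller index set `I`, so the
    -- induction hypothesis applies to it too.
    rw [inter_iUnion₂]
    exact ih (fun j => A i ∩ A j) fun j hj => hinter _ _ hAi (hI j hj)

theorem biUnion_of_disjoint {ι : Type*} (I : Finset ι) (A : ι → Set α)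
    (hA : ∀ i ∈ I, (A i).HasRationalGrowth deg) (hdisj : ∀ i j, i ≠ j → Disjoint (A i) (A j)) :
    (⋃ i ∈ I, A i).HasRationalGrowth deg := by
  classical
  induction I using Finset.induction_on with
  | empty => simpa using HasRationalGrowth.empty deg
  | insert i I hi ih =>
    rw [Finset.set_biUnion_insert]
    refine (hA i (Finset.mem_insert_self i I)).union_of_disjoint
      (ih fun j hj => hA j (Finset.mem_insert_of_mem hj)) ?_
    rw [disjoint_iUnion₂_right]
    exact fun j hj => hdisj i j fun h => hi (h ▸ hj)

end HasRationalGrowth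

end Set

/-! ### Upper and lower sets in `ℕ^n` with positive weights -/

section LowerSets

variable {ι : Type*} [DecidableEq ι] {w : (ι → ℕ) →+ ℕ}

theorem apply_le_weight (hw : ∀ i, 0 < w (Pi.single i 1)) (u : ι → ℕ) (i : ι) : u i ≤ w u := by
  have h : u i • Pi.single i 1 ≤ u := by
    intro j
    rcases eq_or_ne j i with rfl | hj
    · simp
    · simp [hj]
  obtain ⟨v, hv⟩ := exists_add_of_le h
  have hwu : w u = u i * w (Pi.single i 1) + w v := by
    conv_lhs => rw [hv]
    rw [map_add, map_nsmul, smul_eq_mul]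
  have := Nat.le_mul_of_pos_right (u i) (hw i)
  omega

variable [Finite ι]

theorem finite_sep_weight_eq (hw : ∀ i, 0 < w (Pi.single i 1)) (s : Set (ι → ℕ)) (k : ℕ) :
    {u ∈ s | w u = k}.Finite := by
  have := Fintype.ofFinite ι
  refine (Set.finite_Iic (fun _ : ι => k)).subset fun u hu i => ?_
  exact (apply_le_weight hw u i).trans_eq hu.2

/-- Freeing the coordinate `i` gives `B = A ⊔ (e_i + B)`, hence `(1 - z^{w(e_i)}) B(z) = A(z)`. -/
theorem hasRationalGrowth_setOf_support_subset (hw : ∀ i, 0 < w (Pi.single i 1)) (s : Finset ι) :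
    {u : ι → ℕ | ∀ i ∉ s, u i = 0}.HasRationalGrowth w := by
  induction s using Finset.induction_on with
  | empty =>
    have h : {u : ι → ℕ | ∀ i ∉ (∅ : Finset ι), u i = 0} = {0} := by
      ext u
      simp [funext_iff]
    rw [h]
    refine ⟨finite_sep_weight_eq hw _, ?_⟩
    rw [Set.degreeSeries_singleton]
    simpa using PowerSeries.IsRational.of_polynomial (1 : Polynomial ℚ)
  | insert i s hi ih =>
    set A : Set (ι → ℕ) := {u | ∀ j ∉ s, u j = 0}
    set B : Set (ι → ℕ) := {u | ∀ j ∉ insert i s, u j = 0}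
    refine ⟨finite_sep_weight_eq hw _, ?_⟩
    have hunion : B = A ∪ (Pi.single i 1 + ·) '' B := by
      ext u
      constructor
      · intro hu
        rcases Nat.eq_zero_or_pos (u i) with h0 | hpos
        · left
          intro j hj
          rcases eq_or_ne j i with rfl | hji
          · exact h0
          · exact hu j (by simp [hj, hji])
        · right
          have hle : Pi.single i 1 ≤ u := by
            intro j
            rcases eq_or_ne j i with rfl | hji
            · simpa [Nat.one_le_iff_ne_zero] using hpos.ne'
            · simp [hji]
          obtain ⟨v, rfl⟩ := exists_add_of_le hle
          refine ⟨v, fun j hj => ?_, rfl⟩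
          have := hu j hj
          simp only [Pi.add_apply] at this
          omega
      · rintro (hu | ⟨v, hv, rfl⟩) j hj
        · exact hu j fun h => hj (Finset.mem_insert_of_mem h)
        · have hji : j ≠ i := fun h => hj (h ▸ Finset.mem_insert_self i s)
          simp [hji, hv j hj]
    have hdisj : Disjoint A ((Pi.single i 1 + ·) '' B) := by
      rw [Set.disjoint_left]
      rintro _ hA ⟨v, hv, rfl⟩
      simpa using hA i hi
    have hseries := Set.degreeSeries_union (finite_sep_weight_eq hw A)
      (finite_sep_weight_eq hw _) hdisj
    rw [← hunion, Set.degreeSeries_image (deg := w) (c := w (Pi.single i 1))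
      (add_right_injective _).injOn (fun v _ => by simp [add_comm])] at hseries
    have hne : (1 - Polynomial.X ^ w (Pi.single i 1) : Polynomial ℚ) ≠ 0 := by
      rw [← neg_sub, neg_ne_zero]
      exact Polynomial.X_pow_sub_C_ne_zero (hw i) 1
    refine PowerSeries.IsRational.of_polynomial_mul hne ?_
    convert ih.isRational using 1
    push_cast
    rw [sub_mul, one_mul, sub_eq_iff_eq_add]
    exact hseries

theorem hasRationalGrowth_univ (hw : ∀ i, 0 < w (Pi.single i 1)) :
    (Set.univ : Set (ι → ℕ)).HasRationalGrowth w := by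
  have := Fintype.ofFinite ι
  simpa using hasRationalGrowth_setOf_support_subset hw Finset.univ

theorem hasRationalGrowth_Ici (hw : ∀ i, 0 < w (Pi.single i 1)) (a : ι → ℕ) :
    (Set.Ici a).HasRationalGrowth w := by
  have h : Set.Ici a = (a + ·) '' Set.univ := by
    ext u
    simp [le_iff_exists_add, eq_comm]
  rw [h]
  exact (hasRationalGrowth_univ hw).image (c := w a) (add_right_injective a).injOn
    fun v _ => by simp [add_comm]

/-- In a well-quasi-order every set lies above finitely many of its elements. -/
theorem exists_finset_subset_forall_exists_le {α : Type*} [PartialOrder α] [WellQuasiOrderedLE α]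
    (s : Set α) : ∃ I : Finset α, ↑I ⊆ s ∧ ∀ x ∈ s, ∃ a ∈ I, a ≤ x := by
  have hfin : {x | Minimal (· ∈ s) x}.Finite :=
    WellQuasiOrderedLE.finite_of_isAntichain (setOfPred_minimal_antichain _)
  refine ⟨hfin.toFinset, fun x hx => (hfin.mem_toFinset.1 hx).prop, fun x hx => ?_⟩
  obtain ⟨a, hax, ha⟩ := exists_minimal_le_of_wellFoundedLT (· ∈ s) x hx
  exact ⟨a, hfin.mem_toFinset.2 ha, hax⟩

/-- By Dickson's lemma an upper set is a finite union of orthants, and two orthants meet in an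
orthant. -/
theorem IsUpperSet.hasRationalGrowth (hw : ∀ i, 0 < w (Pi.single i 1)) {U : Set (ι → ℕ)}
    (hU : IsUpperSet U) : U.HasRationalGrowth w := by
  obtain ⟨I, hIU, hI⟩ := exists_finset_subset_forall_exists_le U
  have h : U = ⋃ a ∈ I, Set.Ici a := by
    ext u
    simp only [Set.mem_iUnion, Set.mem_Ici, exists_prop]
    exact ⟨hI u, fun ⟨a, ha, hau⟩ => hU hau (hIU ha)⟩
  rw [h]
  refine Set.HasRationalGrowth.biUnion_of_inter (C := fun s => ∃ a, s = Set.Ici a) ?_ ?_ I _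
    fun a _ => ⟨a, rfl⟩
  · rintro _ ⟨a, rfl⟩
    exact hasRationalGrowth_Ici hw a
  · rintro _ _ ⟨a, rfl⟩ ⟨b, rfl⟩
    exact ⟨a ⊔ b, Set.Ici_inter_Ici⟩

theorem IsLowerSet.hasRationalGrowth (hw : ∀ i, 0 < w (Pi.single i 1)) {L : Set (ι → ℕ)}
    (hL : IsLowerSet L) : L.HasRationalGrowth w := by
  have h := (hasRationalGrowth_univ hw).sdiff_of_subset (hL.compl.hasRationalGrowth hw)
    (Set.subset_univ _)
  rwa [← Set.compl_eq_univ_sdiff, compl_compl] at h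

end LowerSets

/-! ### Translates of finitely generated monoids -/

open scoped Pointwise

/-- A set of the form `F + M` with `F` finite and `M` a finitely generated submonoid in which only
`0` has degree zero. -/
def IsFGTranslateSet {Γ : Type*} [AddCommMonoid Γ] (deg : Γ →+ ℕ) (A : Set Γ) : Prop :=
  ∃ (F : Set Γ) (M : AddSubmonoid Γ),
    F.Finite ∧ M.FG ∧ (∀ x ∈ M, deg x = 0 → x = 0) ∧ A = F + (M : Set Γ)

namespace AddSubmonoid

variable {Γ : Type*} [AddCommMonoid Γ]

/-- Discarding `0` from the generators is what later makes every weight `deg (φ e_i)` positive. -/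
theorem FG.exists_pi_addMonoidHom {M : AddSubmonoid Γ} (hM : M.FG) :
    ∃ (n : ℕ) (φ : (Fin n → ℕ) →+ Γ), AddMonoidHom.mrange φ = M ∧ ∀ i, φ (Pi.single i 1) ≠ 0 := by
  classical
  obtain ⟨S, rfl⟩ := hM
  set T := S.erase 0
  let e := T.equivFin.symm
  let φ : (Fin T.card → ℕ) →+ Γ := (Fintype.linearCombination ℕ fun i => (e i : Γ)).toAddMonoidHom
  refine ⟨T.card, φ, ?_, fun i => ?_⟩
  · have hrange : Set.range (fun i => (e i : Γ)) = (T : Set Γ) := by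
      rw [show (fun i => (e i : Γ)) = Subtype.val ∘ e from rfl, e.surjective.range_comp]
      simp
    have hST : closure (S : Set Γ) = closure (T : Set Γ) := by
      simp [T, closure_sdiff_singleton_zero]
    rw [hST, ← hrange, ← Submodule.span_nat_eq_addSubmonoidClosure,
      ← Fintype.range_linearCombination]
    rfl
  · have h : φ (Pi.single i 1) = e i := by
      simp [φ, Fintype.linearCombination_apply_single]
    rw [h]
    exact Finset.ne_of_mem_erase (e i).2

/-- The intersection is the image of the equalizer of the two parametrizations, a finitely generated
submonoid of `ℕ^m × ℕ^n`. -/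
theorem FG.inf [IsCancelAdd Γ] {M N : AddSubmonoid Γ} (hM : M.FG) (hN : N.FG) : (M ⊓ N).FG := by
  obtain ⟨m, φ, rfl, -⟩ := hM.exists_pi_addMonoidHom
  obtain ⟨n, ψ, rfl, -⟩ := hN.exists_pi_addMonoidHom
  have h := (AddSubmonoid.fg_eqLocusM (φ.comp (AddMonoidHom.fst _ _))
    (ψ.comp (AddMonoidHom.snd (Fin m → ℕ) (Fin n → ℕ)))).map (φ.comp (AddMonoidHom.fst _ _))
  convert h
  ext x
  constructor
  · rintro ⟨⟨u, rfl⟩, ⟨v, hv⟩⟩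
    exact ⟨(u, v), hv.symm, rfl⟩
  · rintro ⟨⟨u, v⟩, huv, rfl⟩
    exact ⟨⟨u, rfl⟩, ⟨v, huv.symm⟩⟩

/-- The intersection of two cosets of finitely generated submonoids is finitely generated over the
intersection of the submonoids. -/
theorem FG.exists_finite_vadd_inter_vadd [IsCancelAdd Γ] {M N : AddSubmonoid Γ} (hM : M.FG)
    (hN : N.FG) (a b : Γ) :
    ∃ F : Set Γ, F.Finite ∧
      ({a} + (M : Set Γ)) ∩ ({b} + (N : Set Γ)) = F + ((M ⊓ N : AddSubmonoid Γ) : Set Γ) := by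
  obtain ⟨m, φ, rfl, -⟩ := hM.exists_pi_addMonoidHom
  obtain ⟨n, ψ, rfl, -⟩ := hN.exists_pi_addMonoidHom
  -- Subtracting a minimal solution from a solution leaves, by cancellation, `φ u' = ψ v'`, an
  -- element of both monoids.
  obtain ⟨I, hIs, hI⟩ := exists_finset_subset_forall_exists_le
    {p : (Fin m → ℕ) × (Fin n → ℕ) | a + φ p.1 = b + ψ p.2}
  refine ⟨(fun p : (Fin m → ℕ) × (Fin n → ℕ) => a + φ p.1) '' (I : Set _),
    I.finite_toSet.image _, ?_⟩
  rw [Set.singleton_add, Set.singleton_add]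
  ext x
  constructor
  · rintro ⟨⟨_, ⟨u, rfl⟩, rfl⟩, ⟨_, ⟨v, rfl⟩, huv⟩⟩
    obtain ⟨⟨u₀, v₀⟩, hp, hle⟩ := hI (u, v) huv.symm
    obtain ⟨u', rfl⟩ := exists_add_of_le hle.1
    obtain ⟨v', rfl⟩ := exists_add_of_le hle.2
    have h₀ : a + φ u₀ = b + ψ v₀ := hIs hp
    refine ⟨_, ⟨_, hp, rfl⟩, φ u', ⟨⟨u', rfl⟩, ⟨v', ?_⟩⟩, ?_⟩
    · have h : b + ψ (v₀ + v') = a + φ (u₀ + u') := huv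
      rw [map_add, map_add, ← add_assoc, ← add_assoc, h₀] at h
      exact add_left_cancel h
    · simp only [map_add, add_assoc]
  · rintro ⟨_, ⟨⟨u, v⟩, hp, rfl⟩, y, ⟨⟨u', rfl⟩, ⟨v', hv'⟩⟩, rfl⟩
    have h₀ : a + φ u = b + ψ v := hIs hp
    refine ⟨⟨φ (u + u'), ⟨_, rfl⟩, ?_⟩, ⟨ψ (v + v'), ⟨_, rfl⟩, ?_⟩⟩
    · simp only [map_add, add_assoc]
    · simp only [map_add, hv', ← add_assoc, h₀]

end AddSubmonoid

namespace IsFGTranslateSet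

variable {Γ : Type*} [AddCancelCommMonoid Γ] {deg : Γ →+ ℕ} {A B : Set Γ}

theorem inter (hA : IsFGTranslateSet deg A) (hB : IsFGTranslateSet deg B) :
    IsFGTranslateSet deg (A ∩ B) := by
  obtain ⟨F, M, hF, hM, hdM, rfl⟩ := hA
  obtain ⟨F', N, hF', hN, hdN, rfl⟩ := hB
  choose E hE hEeq using hM.exists_finite_vadd_inter_vadd hN
  refine ⟨⋃ a ∈ F, ⋃ b ∈ F', E a b, M ⊓ N, hF.biUnion fun a _ => hF'.biUnion fun b _ => hE a b,
    hM.inf hN, fun x hx => hdM x hx.1, ?_⟩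
  simp only [Set.iUnion_add, ← hEeq]
  ext x
  simp only [Set.mem_inter_iff, Set.mem_iUnion, Set.mem_add, Set.mem_singleton_iff,
    exists_eq_left, exists_prop]
  constructor
  · rintro ⟨⟨a, ha, y, hy, hx⟩, ⟨b, hb, z, hz, hx'⟩⟩
    exact ⟨a, ha, b, hb, ⟨y, hy, hx⟩, ⟨z, hz, hx'⟩⟩
  · rintro ⟨a, ha, b, hb, ⟨y, hy, hx⟩, ⟨z, hz, hx'⟩⟩
    exact ⟨⟨a, ha, y, hy, hx⟩, ⟨b, hb, z, hz, hx'⟩⟩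

/-- Adding one point `a` to `F` contributes only the part of `a + M` outside `F + M`, which is in
bijection with a lower set of `ℕ^n`. -/
theorem hasRationalGrowth (hA : IsFGTranslateSet deg A) : A.HasRationalGrowth deg := by
  obtain ⟨F, M, hF, hM, hdM, rfl⟩ := hA
  obtain ⟨n, φ, rfl, hφ⟩ := hM.exists_pi_addMonoidHom
  have hw : ∀ i, 0 < (deg.comp φ) (Pi.single i 1) := fun i =>
    Nat.pos_of_ne_zero fun h => hφ i (hdM _ ⟨_, rfl⟩ h)
  induction F, hF using Set.Finite.induction_on with
  | empty => simpa using Set.HasRationalGrowth.empty deg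
  | @insert a F ha hF ih =>
    set R : Set Γ := F + ((AddMonoidHom.mrange φ : AddSubmonoid Γ) : Set Γ)
    -- Representatives which are lexicographically minimal for their value.
    set L : Set (Fin n → ℕ) :=
      {u | a + φ u ∉ R ∧ ∀ v, φ v = φ u → toLex u ≤ toLex v}
    -- Both conditions descend: `R` absorbs `M`, and the lexicographic order is compatible with
    -- addition.
    have hL : IsLowerSet L := by
      rintro u u' hle ⟨huR, humin⟩
      obtain ⟨z, rfl⟩ := exists_add_of_le hle
      refine ⟨?_, fun v hv => ?_⟩
      · rintro ⟨f, hf, y, ⟨t, rfl⟩, hy⟩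
        refine huR ⟨f, hf, _, ⟨t + z, rfl⟩, ?_⟩
        simp only [map_add, ← add_assoc] at hy ⊢
        rw [hy]
      · have h := humin (v + z) (by simp [hv])
        exact le_of_add_le_add_right (a := toLex z) h
    have himage : (insert a F) + ((AddMonoidHom.mrange φ : AddSubmonoid Γ) : Set Γ) =
        R ∪ (fun u => a + φ u) '' L := by
      ext x
      constructor
      · rintro ⟨f, hf, y, ⟨u, rfl⟩, rfl⟩
        by_cases hR : f + φ u ∈ R
        · exact Or.inl hR
        rcases hf with rfl | hf
        · obtain ⟨v, hv, hmin⟩ := (inferInstance : WellFoundedLT (Lex (Fin n → ℕ))).wf.has_min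
            {v | φ (ofLex v) = φ u} ⟨toLex u, rfl⟩
          have hv' : φ (ofLex v) = φ u := hv
          refine Or.inr ⟨ofLex v, ⟨?_, fun t ht => ?_⟩, ?_⟩
          · rwa [hv']
          · exact not_lt.1 (hmin (toLex t) (ht.trans hv'))
          · simp [hv']
        · exact absurd ⟨f, hf, _, ⟨u, rfl⟩, rfl⟩ hR
      · rintro (⟨f, hf, y, hy, rfl⟩ | ⟨u, hu, rfl⟩)
        · exact ⟨f, Or.inr hf, y, hy, rfl⟩
        · exact ⟨a, Or.inl rfl, _, ⟨u, rfl⟩, rfl⟩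
    rw [himage]
    refine ih.union_of_disjoint ((hL.hasRationalGrowth hw).image (c := deg a) ?_ ?_) ?_
    · intro u hu v hv huv
      have h : φ u = φ v := add_left_cancel huv
      exact toLex.injective (le_antisymm (hu.2 v h.symm) (hv.2 u h))
    · intro u _
      simp [add_comm]
    · rw [Set.disjoint_left]
      rintro _ hx ⟨u, hu, rfl⟩
      exact hu.1 hx

end IsFGTranslateSet

/-! ### Removing blocks, orbits and walks -/

/-- A long sequence with finitely many values has a short block, bounded by equal values, whose
removal does not change the set of values. -/
theorem exists_removable_block {Q : Type*} [Finite Q] (f : ℕ → Q) :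
    ∃ i j, i < j ∧ j ≤ i + Nat.card Q ∧ j ≤ Nat.card Q * (Nat.card Q + 1) ∧ f i = f j ∧
      ∀ t, ∃ t' ≤ t, f t' = f t ∧ (t' ≤ i ∨ j < t') := by
  classical
  have := Fintype.ofFinite Q
  set n := Nat.card Q with hn
  have hcard : Fintype.card Q < Fintype.card (Fin (n + 1)) := by
    rw [Fintype.card_fin, hn, Nat.card_eq_fintype_card]
    exact Nat.lt_succ_self _
  -- Some window contains no first occurrence of a value: otherwise the `n + 1` disjoint windows
  -- would give `n + 1` distinct values.
  obtain ⟨a, ha⟩ : ∃ a : Fin (n + 1), ∀ t, a * n < t → t ≤ a * n + n → ∃ t' < t, f t' = f t := by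
    by_contra! h
    choose τ hlt hle hfirst using h
    have key : ∀ a b : Fin (n + 1), a < b → f (τ a) ≠ f (τ b) := by
      intro a b hab
      refine hfirst b (τ a) ?_
      have h₁ : (a + 1 : ℕ) * n ≤ b * n := Nat.mul_le_mul_right n hab
      have h₂ := hle a
      have h₃ := hlt b
      rw [add_mul, one_mul] at h₁
      omega
    obtain ⟨a, b, hab, heq⟩ := Fintype.exists_ne_map_eq_of_card_lt (fun a => f (τ a)) hcard
    rcases hab.lt_or_gt with hab | hab
    · exact key a b hab heq
    · exact key b a hab heq.symm
  -- The left endpoint `a * n` supplies the extra position for the pigeonhole; the removed positions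
  -- `i + 1, ..., j` still lie in the window.
  obtain ⟨x, y, hxy, heq⟩ : ∃ x y : Fin (n + 1), x < y ∧ f (a * n + x) = f (a * n + y) := by
    obtain ⟨x, y, hxy, heq⟩ :=
      Fintype.exists_ne_map_eq_of_card_lt (fun x : Fin (n + 1) => f (a * n + x)) hcard
    rcases hxy.lt_or_gt with hxy | hxy
    · exact ⟨x, y, hxy, heq⟩
    · exact ⟨y, x, hxy, heq.symm⟩
  have hx : (x : ℕ) < y := hxy
  have hy : (y : ℕ) ≤ n := Nat.lt_succ_iff.1 y.2
  have hamul : a * n ≤ n * n := Nat.mul_le_mul_right n (Nat.lt_succ_iff.1 a.2)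
  refine ⟨a * n + x, a * n + y, by omega, by omega, by rw [mul_add, mul_one]; omega, heq,
    fun t => ?_⟩
  have hex : ∃ t', f t' = f t := ⟨t, rfl⟩
  refine ⟨Nat.find hex, Nat.find_min' hex rfl, Nat.find_spec hex, ?_⟩
  by_contra! h
  obtain ⟨t', ht', hft'⟩ := ha (Nat.find hex) (by omega) (by omega)
  exact Nat.find_min hex ht' (hft'.trans (Nat.find_spec hex))

section Orbits

variable {d : ℕ} {V : Type*} [AddAction (Fin d → ℤ) V]

/-- The orbit of a vertex under the translations. -/
def latticeOrbit (d : ℕ) {V : Type*} [AddAction (Fin d → ℤ) V] (v : V) :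
    AddAction.orbitRel.Quotient (Fin d → ℤ) V :=
  Quotient.mk _ v

theorem latticeOrbit_eq_iff {u v : V} :
    latticeOrbit d u = latticeOrbit d v ↔ ∃ g : Fin d → ℤ, g +ᵥ v = u :=
  Quotient.eq.trans AddAction.orbitRel_apply

@[simp]
theorem latticeOrbit_vadd (g : Fin d → ℤ) (v : V) : latticeOrbit d (g +ᵥ v) = latticeOrbit d v :=
  latticeOrbit_eq_iff.2 ⟨g, rfl⟩

end Orbits

namespace SimpleGraph

variable {V : Type*} {G : SimpleGraph V}

theorem finite_setOf_walk_length_le {u : V}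
    (hfin : ∀ v, G.Reachable u v → (G.neighborSet v).Finite) (n : ℕ) :
    {v | ∃ p : G.Walk u v, p.length ≤ n}.Finite := by
  induction n generalizing u with
  | zero =>
    refine (Set.finite_singleton u).subset ?_
    rintro v ⟨p, hp⟩
    exact (Walk.eq_of_length_eq_zero (Nat.le_zero.1 hp)).symm
  | succ n ih =>
    refine ((Set.finite_singleton u).union ((hfin u (Reachable.refl u)).biUnion
      fun t ht => ih (u := t) fun v hv => hfin v ((Adj.reachable ht).trans hv))).subset ?_
    rintro v ⟨p, hp⟩
    cases p with
    | nil => exact Or.inl rfl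
    | cons h p =>
      exact Or.inr (Set.mem_biUnion h ⟨p, by simpa using hp⟩)

theorem edist_le_coe_iff {u v : V} {k : ℕ} :
    G.edist u v ≤ k ↔ ∃ p : G.Walk u v, p.length ≤ k := by
  constructor
  · intro h
    obtain ⟨p, hp⟩ := exists_walk_of_edist_ne_top (h.trans_lt (ENat.natCast_lt_top k)).ne
    exact ⟨p, by rw [← hp] at h; exact_mod_cast h⟩
  · rintro ⟨p, hp⟩
    exact (edist_le p).trans (by exact_mod_cast hp)

end SimpleGraph

/-! ### Decomposing walks into short walks and cycles -/

namespace IsPeriodicGraph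

open SimpleGraph

variable {d : ℕ} {V : Type*} [AddAction (Fin d → ℤ) V] {G : SimpleGraph V}

/-- The translation by `g` as a graph homomorphism. -/
def translate (hG : IsPeriodicGraph d G) (g : Fin d → ℤ) : G →g G :=
  ⟨fun v => g +ᵥ v, fun h => hG.adj_vadd g _ _ h⟩

/-- The translate of a walk. -/
def translateWalk (hG : IsPeriodicGraph d G) (g : Fin d → ℤ) {u v : V} (p : G.Walk u v) :
    G.Walk (g +ᵥ u) (g +ᵥ v) :=
  p.map (hG.translate g)

@[simp]
theorem length_translateWalk (hG : IsPeriodicGraph d G) (g : Fin d → ℤ) {u v : V}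
    (p : G.Walk u v) : (hG.translateWalk g p).length = p.length :=
  Walk.length_map _ _

@[simp]
theorem support_translateWalk (hG : IsPeriodicGraph d G) (g : Fin d → ℤ) {u v : V}
    (p : G.Walk u v) : (hG.translateWalk g p).support = p.support.map (g +ᵥ ·) :=
  Walk.support_map _ _

theorem vadd_left_injective (hG : IsPeriodicGraph d G) (v : V) :
    Function.Injective fun g : Fin d → ℤ => g +ᵥ v := by
  intro g h hgh
  have hgh' : g +ᵥ v = h +ᵥ v := hgh
  have := hG.free (-h + g) v (by rw [add_vadd, hgh', neg_vadd_vadd])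
  rwa [neg_add_eq_zero, eq_comm] at this

variable (G) in
/-- There is a walk of length at most `k` from `u` to `v` that meets every orbit in `S`. -/
def VisitingWalk (S : Set (AddAction.orbitRel.Quotient (Fin d → ℤ) V)) (k : ℕ) (u v : V) : Prop :=
  ∃ p : G.Walk u v, p.length ≤ k ∧ ∀ q ∈ S, ∃ x ∈ p.support, latticeOrbit d x = q

variable (G) in
/-- The pairs of displacement and length bound of nontrivial short walks that become closed in the
quotient, starting in an orbit in `S`. -/
def cycleSteps (v₀ : V) (S : Set (AddAction.orbitRel.Quotient (Fin d → ℤ) V)) (n : ℕ) :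
    Set ((Fin d → ℤ) × ℕ) :=
  {m | 0 < m.2 ∧ m.2 ≤ n ∧ ∃ s, G.Reachable v₀ s ∧ latticeOrbit d s ∈ S ∧
    ∃ p : G.Walk s (m.1 +ᵥ s), p.length ≤ m.2}

variable (G) in
/-- The monoid of displacements by short cycles through orbits in `S`, and by waiting. -/
def cycleMonoid (v₀ : V) (S : Set (AddAction.orbitRel.Quotient (Fin d → ℤ) V)) (n : ℕ) :
    AddSubmonoid ((Fin d → ℤ) × ℕ) :=
  AddSubmonoid.closure (insert (0, 1) (cycleSteps G v₀ S n))

variable {v₀ : V} {S : Set (AddAction.orbitRel.Quotient (Fin d → ℤ) V)} {n : ℕ}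

/-- Since `ℤ^d` is commutative, translating a walk keeps its displacement, so one reachable base
point per orbit suffices, and balls around it are finite. -/
theorem finite_cycleSteps (hG : IsPeriodicGraph d G)
    (hfin : ∀ v, G.Reachable v₀ v → (G.neighborSet v).Finite) :
    (cycleSteps G v₀ S n).Finite := by
  have := hG.finite_orbits
  have hdisp : ∀ q : AddAction.orbitRel.Quotient (Fin d → ℤ) V,
      {g : Fin d → ℤ | ∃ s, G.Reachable v₀ s ∧ latticeOrbit d s = q ∧
        ∃ p : G.Walk s (g +ᵥ s), p.length ≤ n}.Finite := by
    intro q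
    by_cases hq : ∃ s, G.Reachable v₀ s ∧ latticeOrbit d s = q
    · obtain ⟨s, hs, rfl⟩ := hq
      have hball := finite_setOf_walk_length_le (fun v hv => hfin v (hs.trans hv)) n
      refine (hball.preimage (hG.vadd_left_injective s).injOn).subset ?_
      rintro g ⟨t, -, ht, p, hp⟩
      obtain ⟨h, rfl⟩ := latticeOrbit_eq_iff.1 ht.symm
      refine ⟨(hG.translateWalk h p).copy rfl (vadd_comm h g t), ?_⟩
      simpa using hp
    · refine Set.finite_empty.subset ?_
      rintro g ⟨s, hs, hsq, -⟩
      exact hq ⟨s, hs, hsq⟩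
  refine ((Set.finite_iUnion hdisp).prod (Set.finite_Iic n)).subset ?_
  rintro ⟨g, l⟩ ⟨-, hln, s, hs, -, p, hp⟩
  exact ⟨Set.mem_iUnion.2 ⟨latticeOrbit d s, s, hs, rfl, p, hp.trans hln⟩, hln⟩

theorem fg_cycleMonoid (hG : IsPeriodicGraph d G)
    (hfin : ∀ v, G.Reachable v₀ v → (G.neighborSet v).Finite) : (cycleMonoid G v₀ S n).FG :=
  AddSubmonoid.fg_iff _ |>.2 ⟨_, rfl, (hG.finite_cycleSteps hfin).insert _⟩

theorem eq_zero_of_mem_cycleMonoid {m : (Fin d → ℤ) × ℕ} (hm : m ∈ cycleMonoid G v₀ S n)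
    (h : m.2 = 0) : m = 0 := by
  induction hm using AddSubmonoid.closure_induction with
  | mem x hx =>
    rcases hx with rfl | hx
    · simp at h
    · exact absurd h hx.1.ne'
  | zero => rfl
  | add x y _ _ hx hy =>
    obtain ⟨h₁, h₂⟩ := Nat.add_eq_zero_iff.1 (show x.2 + y.2 = 0 from h)
    rw [hx h₁, hy h₂, add_zero]

/-- A translate of the cycle is inserted where the walk meets its base orbit, and the tail is
shifted by `m.1`. Shifting preserves orbits, so `S` is still visited and insertions can be iterated.
-/
theorem VisitingWalk.vadd_of_mem_cycleSteps (hG : IsPeriodicGraph d G) {k : ℕ} {v : V}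
    (hv : VisitingWalk G S k v₀ v) {m : (Fin d → ℤ) × ℕ} (hm : m ∈ cycleSteps G v₀ S n) :
    VisitingWalk G S (k + m.2) v₀ (m.1 +ᵥ v) := by
  classical
  obtain ⟨p, hpk, hpS⟩ := hv
  obtain ⟨-, -, s, -, hs, c, hc⟩ := hm
  obtain ⟨x, hx, hxs⟩ := hpS _ hs
  obtain ⟨h, rfl⟩ := latticeOrbit_eq_iff.1 hxs
  have hlen : (p.takeUntil _ hx).length + (p.dropUntil _ hx).length = p.length := by
    rw [← Walk.length_append, Walk.take_spec]
  refine ⟨((p.takeUntil _ hx).append ((hG.translateWalk h c).copy rfl (vadd_comm h m.1 s))).append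
    (hG.translateWalk m.1 (p.dropUntil _ hx)), ?_, fun q hq => ?_⟩
  · simp only [Walk.length_append, Walk.length_copy, length_translateWalk]
    omega
  · obtain ⟨y, hy, rfl⟩ := hpS q hq
    rw [← Walk.take_spec p hx, Walk.mem_support_append_iff] at hy
    rcases hy with hy | hy
    · exact ⟨y, by simp [Walk.mem_support_append_iff, hy], rfl⟩
    · refine ⟨m.1 +ᵥ y, ?_, latticeOrbit_vadd _ _⟩
      rw [Walk.mem_support_append_iff, support_translateWalk]
      exact Or.inr (List.mem_map_of_mem hy)

theorem VisitingWalk.vadd_of_mem_cycleMonoid (hG : IsPeriodicGraph d G) {k : ℕ} {v : V}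
    (hv : VisitingWalk G S k v₀ v) {m : (Fin d → ℤ) × ℕ} (hm : m ∈ cycleMonoid G v₀ S n) :
    VisitingWalk G S (k + m.2) v₀ (m.1 +ᵥ v) := by
  induction hm using AddSubmonoid.closure_induction generalizing k v with
  | mem x hx =>
    rcases hx with rfl | hx
    · obtain ⟨p, hp, hpS⟩ := hv
      exact ⟨p.copy rfl (zero_vadd _ v).symm, by simp; omega, by simpa using hpS⟩
    · exact hv.vadd_of_mem_cycleSteps hG hx
  | zero => simpa using hv
  | add x y _ _ hx hy =>
    have := hx (hy hv)
    rwa [add_assoc, add_comm y.2, vadd_vadd] at this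

theorem exists_shorter_walk (hG : IsPeriodicGraph d G) {v : V} (p : G.Walk v₀ v)
    (hp : Nat.card (AddAction.orbitRel.Quotient (Fin d → ℤ) V) *
      (Nat.card (AddAction.orbitRel.Quotient (Fin d → ℤ) V) + 1) ≤ p.length)
    (hpS : latticeOrbit d '' {x | x ∈ p.support} = S) :
    ∃ m ∈ cycleSteps G v₀ S (Nat.card (AddAction.orbitRel.Quotient (Fin d → ℤ) V)),
      ∃ (v' : V) (p' : G.Walk v₀ v'), m.1 +ᵥ v' = v ∧ p'.length + m.2 = p.length ∧
        latticeOrbit d '' {x | x ∈ p'.support} = S := by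
  have := hG.finite_orbits
  obtain ⟨i, j, hij, hjn, hjN, heq, hocc⟩ :=
    exists_removable_block fun t => latticeOrbit d (p.getVert t)
  obtain ⟨g, hg⟩ := latticeOrbit_eq_iff.1 heq.symm
  have hback : -g +ᵥ p.getVert j = p.getVert i := by rw [← hg, neg_vadd_vadd]
  -- The block from `i` to `j` is the removed cycle, with displacement `g`; the tail is moved back
  -- by `-g` to start where the block began.
  refine ⟨(g, j - i), ⟨by simpa using hij, by simp; omega, p.getVert i, ⟨p.take i⟩, ?_, ?_⟩,
    -g +ᵥ v, (p.take i).append ((hG.translateWalk (-g) (p.drop j)).copy hback rfl),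
    vadd_neg_vadd g v, ?_, ?_⟩
  · rw [← hpS]
    exact ⟨_, p.getVert_mem_support i, rfl⟩
  · refine ⟨((p.drop i).take (j - i)).copy rfl ?_, ?_⟩
    · rw [Walk.drop_getVert, hg]
      congr 1
      omega
    · simp
  · simp only [Walk.length_append, Walk.length_copy, length_translateWalk, Walk.take_length,
      Walk.drop_length]
    omega
  · rw [← hpS]
    ext q
    constructor
    · rintro ⟨x, hx, rfl⟩
      have hx' : x ∈ ((p.take i).append
        ((hG.translateWalk (-g) (p.drop j)).copy hback rfl)).support := hx
      rw [Walk.mem_support_append_iff, Walk.support_copy, support_translateWalk, List.mem_map] at hx'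
      rcases hx' with hx' | ⟨y, hy, rfl⟩
      · exact ⟨x, (p.isSubwalk_take i).support_subset hx', rfl⟩
      · exact ⟨y, (p.isSubwalk_drop j).support_subset hy, (latticeOrbit_vadd _ _).symm⟩
    · rintro ⟨x, hx, rfl⟩
      obtain ⟨t, rfl, htlen⟩ := Walk.mem_support_iff_exists_getVert.1 hx
      obtain ⟨t', ht't, ht', hpos⟩ := hocc t
      rw [← ht']
      rcases hpos with hpos | hpos
      · refine ⟨p.getVert t', ?_, rfl⟩
        refine (Walk.mem_support_append_iff _ _).2 (Or.inl ?_)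
        have := (p.take i).getVert_mem_support t'
        rwa [Walk.take_getVert, min_eq_right hpos] at this
      · refine ⟨-g +ᵥ p.getVert t', ?_, latticeOrbit_vadd _ _⟩
        refine (Walk.mem_support_append_iff _ _).2 (Or.inr ?_)
        rw [Walk.support_copy, support_translateWalk]
        refine List.mem_map_of_mem (f := (-g +ᵥ ·)) ?_
        have := (p.drop j).getVert_mem_support (t' - j)
        rwa [Walk.drop_getVert, Nat.add_sub_cancel' hpos.le] at this

/-- Blocks are removed until the walk is short. Keeping `S` fixed ensures that the remaining walk
meets the base orbit of every removed cycle. -/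
theorem exists_cycleMonoid_decomposition (hG : IsPeriodicGraph d G) {v : V} (p : G.Walk v₀ v)
    (hpS : latticeOrbit d '' {x | x ∈ p.support} = S) :
    ∃ m ∈ cycleMonoid G v₀ S (Nat.card (AddAction.orbitRel.Quotient (Fin d → ℤ) V)),
      ∃ (k' : ℕ) (v' : V), k' ≤ Nat.card (AddAction.orbitRel.Quotient (Fin d → ℤ) V) *
          (Nat.card (AddAction.orbitRel.Quotient (Fin d → ℤ) V) + 1) ∧
        VisitingWalk G S k' v₀ v' ∧ m.1 +ᵥ v' = v ∧ k' + m.2 = p.length := by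
  induction hk : p.length using Nat.strong_induction_on generalizing v with
  | _ k ih =>
    by_cases hp : p.length ≤ Nat.card (AddAction.orbitRel.Quotient (Fin d → ℤ) V) *
      (Nat.card (AddAction.orbitRel.Quotient (Fin d → ℤ) V) + 1)
    · refine ⟨0, zero_mem _, p.length, v, hp, ⟨p, le_rfl, fun q hq => ?_⟩, zero_vadd _ v, hk⟩
      rw [← hpS] at hq
      exact hq
    · obtain ⟨m, hm, v', p', rfl, hlen, hp'S⟩ := hG.exists_shorter_walk p (not_le.1 hp).le hpS
      have hpos := hm.1
      obtain ⟨m', hm', k'', v'', hk'', hv'', rfl, hlen'⟩ :=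
        ih p'.length (by omega) p' hp'S rfl
      refine ⟨m + m', add_mem (AddSubmonoid.subset_closure (Or.inr hm)) hm', k'', v'', hk'', hv'',
        add_vadd _ _ _, ?_⟩
      rw [Prod.snd_add]
      omega

theorem hasRationalGrowth_setOf_edist_vadd_le (hG : IsPeriodicGraph d G)
    (hfin : ∀ v, G.Reachable v₀ v → (G.neighborSet v).Finite) (r : V) :
    {m : (Fin d → ℤ) × ℕ | G.edist v₀ (m.1 +ᵥ r) ≤ m.2}.HasRationalGrowth
      (AddMonoidHom.snd (Fin d → ℤ) ℕ) := by
  have := hG.finite_orbits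
  have := Fintype.ofFinite (Set (AddAction.orbitRel.Quotient (Fin d → ℤ) V))
  set n := Nat.card (AddAction.orbitRel.Quotient (Fin d → ℤ) V)
  set F : Set (AddAction.orbitRel.Quotient (Fin d → ℤ) V) → Set ((Fin d → ℤ) × ℕ) := fun S =>
    {m | m.2 ≤ n * (n + 1) ∧ VisitingWalk G S m.2 v₀ (m.1 +ᵥ r)}
  have hF : ∀ S, (F S).Finite := by
    intro S
    have hball := finite_setOf_walk_length_le hfin (n * (n + 1))
    refine ((hball.preimage (hG.vadd_left_injective r).injOn).prod
      (Set.finite_Iic (n * (n + 1)))).subset ?_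
    rintro ⟨g, k⟩ ⟨hk, p, hp, -⟩
    exact ⟨⟨p, hp.trans hk⟩, hk⟩
  have hunion : {m : (Fin d → ℤ) × ℕ | G.edist v₀ (m.1 +ᵥ r) ≤ m.2} =
      ⋃ S ∈ Finset.univ, F S + (cycleMonoid G v₀ S n : Set ((Fin d → ℤ) × ℕ)) := by
    ext ⟨g, k⟩
    simp only [Set.mem_ofPred_eq, edist_le_coe_iff, Set.mem_iUnion, Finset.mem_univ, exists_prop,
      true_and]
    constructor
    · rintro ⟨p, hp⟩
      obtain ⟨m, hm, k', v', hk', hv', hmv, hlen⟩ := hG.exists_cycleMonoid_decomposition p rfl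
      -- The set `S` is the set of orbits met by `p`; the slack `k - p.length` is made up by waiting
      -- steps `(0, 1)`.
      refine ⟨_, (-m.1 + g, k'), ⟨hk', ?_⟩, m + (k - p.length) • ((0, 1) : (Fin d → ℤ) × ℕ),
        add_mem hm (nsmul_mem (AddSubmonoid.subset_closure (Set.mem_insert _ _)) _), ?_⟩
      · have hback : (-m.1 + g) +ᵥ r = v' := by rw [add_vadd, ← hmv, neg_vadd_vadd]
        simpa only [hback] using hv'
      · ext1
        · simp
        · simp; omega
    · rintro ⟨S, ⟨g₀, k₀⟩, ⟨-, hv⟩, m, hm, heq⟩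
      obtain ⟨p, hp, -⟩ := hv.vadd_of_mem_cycleMonoid hG hm
      obtain ⟨rfl, rfl⟩ := Prod.mk.inj heq.symm
      exact ⟨p.copy rfl (by rw [vadd_vadd, add_comm]), by simpa using hp⟩
  rw [hunion]
  exact Set.HasRationalGrowth.biUnion_of_inter (fun _ => IsFGTranslateSet.hasRationalGrowth)
    (fun _ _ => IsFGTranslateSet.inter) _ _ fun S _ => ⟨F S, _, hF S, hG.fg_cycleMonoid hfin,
      fun x hx h => eq_zero_of_mem_cycleMonoid hx h, rfl⟩

/-! ### From balls to spheres -/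

theorem hasRationalGrowth_setOf_edist_le (hG : IsPeriodicGraph d G)
    (hfin : ∀ v, G.Reachable v₀ v → (G.neighborSet v).Finite) :
    {x : V × ℕ | G.edist v₀ x.1 ≤ x.2}.HasRationalGrowth Prod.snd := by
  have := hG.finite_orbits
  have := Fintype.ofFinite (AddAction.orbitRel.Quotient (Fin d → ℤ) V)
  have hunion : {x : V × ℕ | G.edist v₀ x.1 ≤ x.2} =
      ⋃ q ∈ (Finset.univ : Finset (AddAction.orbitRel.Quotient (Fin d → ℤ) V)),
      (fun m : (Fin d → ℤ) × ℕ => (m.1 +ᵥ (Quotient.out q : V), m.2)) ''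
        {m | G.edist v₀ (m.1 +ᵥ (Quotient.out q : V)) ≤ m.2} := by
    ext ⟨v, k⟩
    simp only [Set.mem_iUnion, Finset.mem_univ, exists_prop, true_and]
    constructor
    · intro hv
      obtain ⟨g, hg⟩ := latticeOrbit_eq_iff.1
        (show latticeOrbit d v = latticeOrbit d (Quotient.out (latticeOrbit d v)) from
          (Quotient.out_eq _).symm)
      refine ⟨latticeOrbit d v, (g, k), ?_, Prod.ext hg rfl⟩
      simpa only [Set.mem_ofPred_eq, hg] using hv
    · rintro ⟨q, m, hm, heq⟩
      obtain ⟨rfl, rfl⟩ := Prod.mk.inj heq.symm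
      exact hm
  rw [hunion]
  refine Set.HasRationalGrowth.biUnion_of_disjoint _ _ (fun q _ => ?_) fun q q' hqq' => ?_
  · refine (hG.hasRationalGrowth_setOf_edist_vadd_le hfin (Quotient.out q)).image (c := 0) ?_
      fun _ _ => rfl
    rintro ⟨g, k⟩ - ⟨g', k'⟩ - heq
    obtain ⟨h₁, h₂⟩ := Prod.mk.inj heq
    exact Prod.ext (hG.vadd_left_injective _ h₁) h₂
  · rw [Set.disjoint_left]
    rintro _ ⟨m, -, rfl⟩ ⟨m', -, heq⟩
    have h := congrArg (latticeOrbit d) (Prod.mk.inj heq).1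
    rw [latticeOrbit_vadd, latticeOrbit_vadd] at h
    exact hqq' ((Quotient.out_eq q).symm.trans (h.symm.trans (Quotient.out_eq q')))

/-- For fixed `v` the admissible `k` form an up-closed set, so removing its shift by one leaves only
the least `k`, the distance. -/
theorem hasRationalGrowth_setOf_edist_eq (hG : IsPeriodicGraph d G)
    (hfin : ∀ v, G.Reachable v₀ v → (G.neighborSet v).Finite) :
    {x : V × ℕ | G.edist v₀ x.1 = x.2}.HasRationalGrowth Prod.snd := by
  have hball := hG.hasRationalGrowth_setOf_edist_le hfin
  have hshift := hball.image (deg' := Prod.snd) (c := 1) (f := fun x => (x.1, x.2 + 1))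
    (fun x _ y _ h => Prod.ext (Prod.mk.inj h).1 (Nat.succ_injective (Prod.mk.inj h).2))
    fun _ _ => rfl
  have h := hball.sdiff_of_subset hshift ?_
  · convert h using 1
    ext ⟨v, k⟩
    simp only [Set.mem_ofPred_eq, Set.mem_sdiff, Set.mem_image, Prod.mk.injEq, Prod.exists]
    constructor
    · refine fun hv => ⟨hv.le, ?_⟩
      rintro ⟨v, l, hl, rfl, rfl⟩
      rw [hv] at hl
      have : l + 1 ≤ l := by exact_mod_cast hl
      omega
    · rintro ⟨hle, hnot⟩
      refine le_antisymm hle ?_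
      by_contra! hlt
      obtain ⟨l, hl⟩ := ENat.ne_top_iff_exists.1 (hlt.trans (ENat.natCast_lt_top k)).ne
      rw [← hl] at hlt
      have hlk : l < k := by exact_mod_cast hlt
      refine hnot ⟨v, k - 1, ?_, rfl, by omega⟩
      rw [← hl]
      exact_mod_cast Nat.le_sub_one_of_lt hlk
  · rintro _ ⟨⟨v, k⟩, hv, rfl⟩
    have hv' : G.edist v₀ v ≤ k := hv
    exact hv'.trans (by exact_mod_cast Nat.le_succ k)

end IsPeriodicGraph

theorem mainTheorem1 (d : ℕ) {V : Type*} [AddAction (Fin d → ℤ) V] (G : SimpleGraph V)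
    (hG : IsPeriodicGraph d G) (v₀ : V)
    (hfin : ∀ v : V, G.Reachable v₀ v → (G.neighborSet v).Finite) :
    (∀ k : ℕ, (G.sphereAt v₀ k).Finite) ∧
      (generatingFunction (G.coordinationSequence v₀)).IsRational := by
  have h := hG.hasRationalGrowth_setOf_edist_eq hfin
  have himage : ∀ k, (fun v => (v, k)) '' G.sphereAt v₀ k =
      {x ∈ {x : V × ℕ | G.edist v₀ x.1 = x.2} | x.2 = k} := by
    intro k
    ext ⟨v, l⟩
    constructor
    · rintro ⟨v, hv, heq⟩
      obtain ⟨rfl, rfl⟩ := Prod.mk.inj heq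
      exact ⟨hv, rfl⟩
    · rintro ⟨hv, rfl⟩
      exact ⟨v, hv, rfl⟩
  have hinj : ∀ k : ℕ, Function.Injective fun v : V => (v, k) := fun k u v huv =>
    (Prod.mk.inj huv).1
  refine ⟨fun k => ?_, ?_⟩
  · refine Set.Finite.of_finite_image ?_ (hinj k).injOn
    rw [himage]
    exact h.finite k
  · convert h.isRational using 1
    rw [Set.degreeSeries]
    congr 1
    ext k
    rw [SimpleGraph.coordinationSequence, ← himage, (hinj k).injOn.ncard_image]
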